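/- Let $p\ge 1$ and $n\ge 3$. Let $g:[0,\infty)\to[0,\infty)$ be measurable, $\mu\in\mathbb R^p$, and let $\Sigma$ be a real symmetric positive definite $p\times p$ matrix. Let $\mathcal E_p(\mu,\Sigma,g)$ be the probability distribution on $\mathbb R^p$ with Lebesgue density $$f(x)=C\,|\Sigma|^{-1/2}\,g\big((x-\mu)^\top\Sigma^{-1}(x-\mu)\big),$$ where $C>0$ is the normalizing constant and $g$ is scaled so that $\Sigma$ is the covariance matrix of $\mathcal E_p(\mu,\Sigma,g)$. Assume that this distribution has finite fourth-order moments, and let $$\kappa=\frac{\mathbb E[r^4]}{p(p+2)}-1,\qquad r=\|\Sigma^{-1/2}(x-\mu)\|,\quad x\sim\mathcal E_p(\mu,\Sigma,g),$$ be its elliptical kurtosis. Let $x_1,\dots,x_n$ be an i.i.d. sample from $\mathcal E_p(\mu,\Sigma,g)$, with sample mean $\bar x=\frac1n\sum_{i=1}^n x_i$ and sample covariance matrix $$S=\frac1{n-1}\sum_{i=1}^n(x_i-\bar x)(x_i-\bar x)^\top .$$ Let $W=(w_{ij})$ be any real symmetric $p\times p$ matrix with $w_{ii}=1$ and $w_{ij}\ge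 0$ for all $i,j$ (that is, $W\in\mathcal W^+$). Write $\circ$ for the entrywise product, $\|A\|_F^2=\operatorname{tr}(A^\top A)$, and $D_S$ for the diagonal matrix with the same diagonal as $S$. Then $$\hat\vartheta_W=b_n\left(\frac{\|W\circ S\|_F^2}{p}-a_n\,\frac{\operatorname{tr}\big((D_SW)^2\big)}{p}\right),$$ with $$a_n=\frac1{n+\kappa}\left(\frac n{n-1}+\kappa\right),\qquad b_n=\frac{(\kappa+n)(n-1)^2}{(n-2)\big(3\kappa(n-1)+n(n+1)\big)},$$ is an unbiased estimator of $\vartheta_W=\|W\circ\Sigma\|_F^2/p$: it is integrable and $\mathbb E[\hat\vartheta_W]=\vartheta_W$. -/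

import Mathlib

open MeasureTheory ProbabilityTheory
open scoped Matrix

noncomputable section

/-- The squared Frobenius norm `‖A‖_F² = tr(Aᵀ A)`. -/
def frobSq {p : ℕ} (A : Matrix (Fin p) (Fin p) ℝ) : ℝ := (Aᵀ * A).trace

/-- The set `𝒲⁺` of tapering matrices: symmetric, unit diagonal, nonnegative entries. -/
def taperSet (p : ℕ) : Set (Matrix (Fin p) (Fin p) ℝ) :=
  {W | W.IsSymm ∧ (∀ i, W i i = 1) ∧ ∀ i j, 0 ≤ W i j}

/-- The diagonal matrix `D_A` with the same diagonal as `A`. -/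
def diagPart {p : ℕ} (A : Matrix (Fin p) (Fin p) ℝ) : Matrix (Fin p) (Fin p) ℝ :=
  Matrix.diagonal A.diag

/-- The sample mean of `x_1, …, x_n`. -/
def sampleMean {n p : ℕ} (x : Fin n → Fin p → ℝ) : Fin p → ℝ :=
  (n : ℝ)⁻¹ • ∑ i, x i

/-- The (unbiased) sample covariance matrix
`S = (n - 1)⁻¹ ∑ i, (x_i - x̄) (x_i - x̄)ᵀ`. -/
def sampleCov {n p : ℕ} (x : Fin n → Fin p → ℝ) : Matrix (Fin p) (Fin p) ℝ :=
  ((n : ℝ) - 1)⁻¹ • ∑ i, Matrix.vecMulVec (x i - sampleMean x) (x i - sampleMean x)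

/-- The quadratic form `(x - μ)ᵀ Sig⁻¹ (x - μ)`. -/
def mahalanobisSq {p : ℕ} (μ : Fin p → ℝ) (Sig : Matrix (Fin p) (Fin p) ℝ)
    (x : Fin p → ℝ) : ℝ :=
  (x - μ) ⬝ᵥ (Sig⁻¹ *ᵥ (x - μ))

/-- The radius `r = ‖Sig^{-1/2} (x - μ)‖`, i.e. `√((x - μ)ᵀ Sig⁻¹ (x - μ))`. -/
def esRadius {p : ℕ} (μ : Fin p → ℝ) (Sig : Matrix (Fin p) (Fin p) ℝ)
    (x : Fin p → ℝ) : ℝ :=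
  √(mahalanobisSq μ Sig x)

/-- The elliptical density
`f(x) = C |Sig|^{-1/2} g((x - μ)ᵀ Sig⁻¹ (x - μ))` with respect to Lebesgue measure. -/
def esDensity {p : ℕ} (C : ℝ) (μ : Fin p → ℝ) (Sig : Matrix (Fin p) (Fin p) ℝ)
    (g : ℝ → ℝ) (x : Fin p → ℝ) : ℝ :=
  C * (√Sig.det)⁻¹ * g (mahalanobisSq μ Sig x)

/-- `P` is the elliptical distribution `ℰ_p(μ, Sig, g)`. Only the values of the density
generator `g` on `[0, ∞)` matter; the generator is scaled such that the positive definite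
scatter matrix `Sig` is the covariance matrix of `P`. -/
structure IsElliptical {p : ℕ} (P : Measure (Fin p → ℝ)) (μ : Fin p → ℝ)
    (Sig : Matrix (Fin p) (Fin p) ℝ) (g : ℝ → ℝ) : Prop where
  isProbabilityMeasure : IsProbabilityMeasure P
  posDef : Sig.PosDef
  measurable_generator : Measurable g
  generator_nonneg : ∀ t, 0 ≤ t → 0 ≤ g t
  hasDensity : ∃ C : ℝ, 0 < C ∧
    P = volume.withDensity (fun x => ENNReal.ofReal (esDensity C μ Sig g x))
  covariance_eq : ∀ i j, covariance (fun x : Fin p → ℝ => x i) (fun x => x j) P = Sig i j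

/-- The elliptical kurtosis `κ = E[r⁴] / (p (p + 2)) - 1`. -/
def ellKurtosis {p : ℕ} (P : Measure (Fin p → ℝ)) (μ : Fin p → ℝ)
    (Sig : Matrix (Fin p) (Fin p) ℝ) : ℝ :=
  (∫ x, esRadius μ Sig x ^ 4 ∂P) / ((p : ℝ) * ((p : ℝ) + 2)) - 1

/-- The constant `a_n`. -/
def aCoef (n : ℕ) (κ : ℝ) : ℝ :=
  1 / ((n : ℝ) + κ) * ((n : ℝ) / ((n : ℝ) - 1) + κ)

/-- The constant `b_n`. -/
def bCoef (n : ℕ) (κ : ℝ) : ℝ :=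
  ((κ + (n : ℝ)) * ((n : ℝ) - 1) ^ 2) /
    (((n : ℝ) - 2) * (3 * κ * ((n : ℝ) - 1) + (n : ℝ) * ((n : ℝ) + 1)))

/-- The parameter `ϑ_W = ‖W ∘ Sig‖_F² / p`. -/
def thetaW {p : ℕ} (W Sig : Matrix (Fin p) (Fin p) ℝ) : ℝ :=
  frobSq (W ⊙ Sig) / (p : ℝ)

/-- The estimator `b_n (‖W ∘ S‖_F² / p - a_n tr((D_S W)²) / p)` of `ϑ_W` computed from the
sample `x_1, …, x_n`, where `S` is the sample covariance matrix. -/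
def thetaHat {n p : ℕ} (κ : ℝ) (W : Matrix (Fin p) (Fin p) ℝ) (x : Fin n → Fin p → ℝ) : ℝ :=
  bCoef n κ * (frobSq (W ⊙ sampleCov x) / (p : ℝ)
    - aCoef n κ * (((diagPart (sampleCov x) * W) ^ 2).trace / (p : ℝ)))

end

/-! Writing σ for the entries of `Sig`, both E[S_ij²] and E[S_ii S_jj] are linear combinations of
σ_ij² and σ_ii σ_jj. The coefficient a_n is the ratio of the two σ_ii σ_jj weights, so the
difference keeps only σ_ij², and b_n is the reciprocal of its remaining weight (`bCoef_mul_eq`). The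
weights w_ij² do not interact with this, and the identity is summed entry by entry.

The linear combinations have two sources. Elliptical symmetry fixes all needed fourth moments up to
one scalar: reflections preserving the Mahalanobis distance exchange linear forms of equal variance,
so E[(v·(x-μ))⁴] = m (vᵀ Sig v)². Polarization gives the mixed moments, and computing E[r⁴]
identifies m = 3(1+κ). Independence then gives `integral_sampleCov_mul_sampleCov`: S is a quadratic
form in the centred sample, and only index patterns that pair up the four factors contribute. -/

/-! ### Reflection symmetries of an elliptical law. -/

theorem measurePreserving_withDensity {α : Type*} [MeasurableSpace α] {ν : Measure α}
    {T : α → α} (hT : MeasurePreserving T ν ν) {f : α → ENNReal} (hf : Measurable f)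
    (hfT : ∀ x, f (T x) = f x) :
    MeasurePreserving T (ν.withDensity f) (ν.withDensity f) := by
  refine ⟨hT.measurable, ?_⟩
  ext s hs
  rw [Measure.map_apply hT.measurable hs, withDensity_apply _ (hT.measurable hs),
    withDensity_apply _ hs, ← hT.setLIntegral_comp_preimage hs hf]
  simp_rw [hfT]

/-- L² = 1 forces det L = ±1, so Lebesgue measure is not rescaled. -/
theorem measurePreserving_of_involutive {p : ℕ} (L : (Fin p → ℝ) →ₗ[ℝ] (Fin p → ℝ))
    (hL : L ∘ₗ L = LinearMap.id) : MeasurePreserving L volume volume := by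
  have hdet : LinearMap.det L * LinearMap.det L = 1 := by
    rw [← LinearMap.det_comp, hL, LinearMap.det_id]
  have hne : LinearMap.det L ≠ 0 := left_ne_zero_of_mul_eq_one hdet
  refine ⟨(LinearMap.continuous_of_finiteDimensional L).measurable, ?_⟩
  rw [Real.map_linearMap_volume_pi_eq_smul_volume_pi hne]
  have : |(LinearMap.det L)⁻¹| = 1 := by
    rcases mul_self_eq_one_iff.1 hdet with h | h <;> simp [h]
  simp [this]

theorem measurable_mahalanobisSq {p : ℕ} (μ : Fin p → ℝ) (Sig : Matrix (Fin p) (Fin p) ℝ) :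
    Measurable (mahalanobisSq μ Sig) := by
  apply Continuous.measurable
  unfold mahalanobisSq
  fun_prop

theorem Matrix.PosDef.transpose_eq {p : ℕ} {A : Matrix (Fin p) (Fin p) ℝ} (hA : A.PosDef) :
    Aᵀ = A := by
  simpa [Matrix.conjTranspose_eq_transpose_of_trivial] using hA.isHermitian.eq

theorem Matrix.dotProduct_mulVec_comm_of_transpose_eq {p : ℕ} {A : Matrix (Fin p) (Fin p) ℝ}
    (hA : Aᵀ = A) (v w : Fin p → ℝ) : v ⬝ᵥ (A *ᵥ w) = w ⬝ᵥ (A *ᵥ v) := by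
  rw [Matrix.dotProduct_mulVec, ← Matrix.mulVec_transpose, hA, dotProduct_comm]

namespace IsElliptical

variable {p : ℕ} {P : Measure (Fin p → ℝ)} {μ : Fin p → ℝ} {Sig : Matrix (Fin p) (Fin p) ℝ}
  {g : ℝ → ℝ}

/-- An elliptical distribution is invariant under the linear involutions, centred at its location
parameter, that preserve the Mahalanobis distance. -/
theorem measurePreserving (hP : IsElliptical P μ Sig g)
    (L : (Fin p → ℝ) →ₗ[ℝ] (Fin p → ℝ)) (hL : L ∘ₗ L = LinearMap.id)
    (hLq : ∀ y, L y ⬝ᵥ (Sig⁻¹ *ᵥ L y) = y ⬝ᵥ (Sig⁻¹ *ᵥ y)) :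
    MeasurePreserving (fun x => μ + L (x - μ)) P P := by
  obtain ⟨C, -, hC⟩ := hP.hasDensity
  rw [hC]
  refine measurePreserving_withDensity ?_ ?_ ?_
  · exact (measurePreserving_add_left volume μ).comp
      ((measurePreserving_of_involutive L hL).comp (measurePreserving_sub_right volume μ))
  · unfold esDensity
    exact ((hP.measurable_generator.comp (measurable_mahalanobisSq μ Sig)).const_mul _).ennreal_ofReal
  · intro x
    simp only [esDensity, mahalanobisSq, add_sub_cancel_left, hLq]

theorem integral_comp (hP : IsElliptical P μ Sig g)
    (L : (Fin p → ℝ) →ₗ[ℝ] (Fin p → ℝ)) (hL : L ∘ₗ L = LinearMap.id)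
    (hLq : ∀ y, L y ⬝ᵥ (Sig⁻¹ *ᵥ L y) = y ⬝ᵥ (Sig⁻¹ *ᵥ y)) {F : (Fin p → ℝ) → ℝ}
    (hF : Measurable F) :
    ∫ x, F (L (x - μ)) ∂P = ∫ x, F (x - μ) ∂P := by
  have h := hP.measurePreserving L hL hLq
  have hm : Measurable fun x : Fin p → ℝ => F (x - μ) := hF.comp (measurable_id.sub_const μ)
  conv_rhs => rw [← h.map_eq]
  rw [integral_map h.measurable.aemeasurable hm.aestronglyMeasurable]
  simp

theorem integral_sub_eq_zero (hP : IsElliptical P μ Sig g) (i : Fin p) :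
    ∫ x, (x i - μ i) ∂P = 0 := by
  have h := hP.integral_comp (-LinearMap.id) (by ext; simp) (by simp [Matrix.mulVec_neg])
    (measurable_pi_apply i)
  simp only [LinearMap.neg_apply, LinearMap.id_apply, Pi.neg_apply, Pi.sub_apply,
    integral_neg] at h
  linarith

theorem integral_mul_eq (hP : IsElliptical P μ Sig g) (hint : ∀ j, Integrable (fun x : Fin p → ℝ => x j) P)
    (i j : Fin p) :
    ∫ x, (x i - μ i) * (x j - μ j) ∂P = Sig i j := by
  have := hP.isProbabilityMeasure
  have hmean : ∀ k, ∫ x : Fin p → ℝ, x k ∂P = μ k := fun k => by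
    have h := hP.integral_sub_eq_zero k
    rw [integral_sub (hint k) (integrable_const _)] at h
    simp at h
    linarith
  rw [← hP.covariance_eq i j]
  simp [covariance, hmean]

/-- The fourth moments of two linear forms of equal variance agree: the linear forms are exchanged
by a reflection that preserves the Mahalanobis distance. -/
theorem integral_pow_four_congr (hP : IsElliptical P μ Sig g) {v w : Fin p → ℝ}
    (hvw : v ⬝ᵥ (Sig *ᵥ v) = w ⬝ᵥ (Sig *ᵥ w)) :
    ∫ x, (v ⬝ᵥ (x - μ)) ^ 4 ∂P = ∫ x, (w ⬝ᵥ (x - μ)) ^ 4 ∂P := by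
  by_cases hne : v = w
  · rw [hne]
  set u := v - w with hu
  have hu0 : u ≠ 0 := sub_ne_zero.2 hne
  have hsym := hP.posDef.transpose_eq
  set s := u ⬝ᵥ (Sig *ᵥ u) with hs
  have hs0 : s ≠ 0 := by
    have := hP.posDef.dotProduct_mulVec_pos hu0
    simp at this
    exact this.ne'
  -- This is where equal variance enters: s = 2(vᵀ Sig v - vᵀ Sig w) and wᵀ Sig u = vᵀ Sig w - vᵀ
  -- Sig v.
  have hwu : 2 * (w ⬝ᵥ (Sig *ᵥ u)) = -s := by
    have := Matrix.dotProduct_mulVec_comm_of_transpose_eq hsym v w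
    simp only [hs, hu, Matrix.mulVec_sub, dotProduct_sub, sub_dotProduct]
    linarith
  have hinv : ∀ y, y ⬝ᵥ (Sig⁻¹ *ᵥ (Sig *ᵥ u)) = u ⬝ᵥ y := fun y => by
    rw [Matrix.mulVec_mulVec, Matrix.nonsing_inv_mul _ ((Matrix.isUnit_iff_isUnit_det _).1 hP.posDef.isUnit), Matrix.one_mulVec,
      dotProduct_comm]
  have hinv' : ∀ y, (Sig *ᵥ u) ⬝ᵥ (Sig⁻¹ *ᵥ y) = u ⬝ᵥ y := fun y => by
    rw [Matrix.dotProduct_mulVec_comm_of_transpose_eq hP.posDef.inv.transpose_eq, hinv]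
  -- The reflection along Sig u, orthogonal for the inner product of Sig⁻¹; its adjoint carries w to
  -- v.
  let L : (Fin p → ℝ) →ₗ[ℝ] (Fin p → ℝ) :=
    { toFun := fun y => y - (2 * (u ⬝ᵥ y) / s) • (Sig *ᵥ u)
      map_add' := fun y z => by
        simp only [dotProduct_add]; module
      map_smul' := fun c y => by
        simp only [dotProduct_smul, smul_eq_mul, RingHom.id_apply]; module }
  have hLa : ∀ y, L y = y - (2 * (u ⬝ᵥ y) / s) • (Sig *ᵥ u) := fun _ => rfl
  have hL : L ∘ₗ L = LinearMap.id := by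
    refine LinearMap.ext fun y => ?_
    have h1 : 2 * (u ⬝ᵥ y - 2 * (u ⬝ᵥ y) / s * s) / s = -(2 * (u ⬝ᵥ y) / s) := by
      field_simp; ring
    simp only [LinearMap.comp_apply, LinearMap.id_apply, hLa, dotProduct_sub, dotProduct_smul,
      smul_eq_mul, ← hs, h1]
    module
  have hLq : ∀ y, L y ⬝ᵥ (Sig⁻¹ *ᵥ L y) = y ⬝ᵥ (Sig⁻¹ *ᵥ y) := fun y => by
    simp only [hLa, Matrix.mulVec_sub, Matrix.mulVec_smul, dotProduct_sub, sub_dotProduct,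
      dotProduct_smul, smul_dotProduct, smul_eq_mul, hinv, hinv', ← hs]
    field_simp
    ring
  have hwL : ∀ y, w ⬝ᵥ L y = v ⬝ᵥ y := fun y => by
    have h2 : w ⬝ᵥ (Sig *ᵥ u) = -s / 2 := by linarith
    have h3 : u ⬝ᵥ y = v ⬝ᵥ y - w ⬝ᵥ y := by rw [hu, sub_dotProduct]
    simp only [hLa, dotProduct_sub, dotProduct_smul, smul_eq_mul, h2, h3]
    field_simp
    ring
  have hm : Measurable fun y : Fin p → ℝ => (w ⬝ᵥ y) ^ 4 := by
    apply Continuous.measurable; fun_prop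
  have := hP.integral_comp L hL hLq hm
  simpa only [hwL] using this

end IsElliptical

/-! ### Fourth moments of an elliptical law and the kurtosis. -/

theorem memLp_four_of_integrable_pow {α : Type*} [MeasurableSpace α] {ν : Measure α} {f : α → ℝ}
    (hf : AEStronglyMeasurable f ν) (h : Integrable (fun x => f x ^ 4) ν) : MemLp f 4 ν := by
  rw [← integrable_norm_rpow_iff hf (by norm_num) (by norm_num)]
  refine h.congr (Filter.Eventually.of_forall fun x => ?_)
  simp only [ENNReal.toReal_ofNat, Real.norm_eq_abs]
  rw [show (4 : ℝ) = ((4 : ℕ) : ℝ) by norm_num, Real.rpow_natCast, (by decide : Even 4).pow_abs]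

theorem MeasureTheory.MemLp.mul_memLp_two {α : Type*} [MeasurableSpace α] {ν : Measure α}
    {f g : α → ℝ} (hf : MemLp f 4 ν) (hg : MemLp g 4 ν) : MemLp (fun x => f x * g x) 2 ν := by
  have : ENNReal.HolderTriple 4 4 2 := ⟨by
    rw [← ENNReal.toReal_eq_toReal_iff' (by simp) (by simp), ENNReal.toReal_add (by simp) (by simp)]
    simp [ENNReal.toReal_inv]
    norm_num⟩
  exact hg.mul hf

theorem MeasureTheory.MemLp.integrable_mul_four {α : Type*} [MeasurableSpace α] {ν : Measure α}
    {a b c d : α → ℝ} (ha : MemLp a 4 ν) (hb : MemLp b 4 ν) (hc : MemLp c 4 ν)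
    (hd : MemLp d 4 ν) : Integrable (fun x => a x * b x * (c x * d x)) ν :=
  (ha.mul_memLp_two hb).integrable_mul (hc.mul_memLp_two hd)

/-- B is a whitening matrix: A^{-1/2} up to an orthogonal factor on the left. -/
theorem Matrix.PosDef.exists_inv_eq_transpose_mul_self {p : ℕ} {A : Matrix (Fin p) (Fin p) ℝ}
    (hA : A.PosDef) : ∃ B : Matrix (Fin p) (Fin p) ℝ, A⁻¹ = Bᵀ * B ∧ B * A * Bᵀ = 1 := by
  open MatrixOrder in
  obtain ⟨B, hB⟩ := CStarAlgebra.nonneg_iff_eq_star_mul_self.mp hA.inv.posSemidef.nonneg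
  rw [Matrix.star_eq_conjTranspose, Matrix.conjTranspose_eq_transpose_of_trivial] at hB
  have hdet := (Matrix.isUnit_iff_isUnit_det _).1 hA.isUnit
  refine ⟨B, hB, ?_⟩
  have h1 : (A * Bᵀ) * B = 1 := by
    rw [Matrix.mul_assoc, ← hB, Matrix.mul_nonsing_inv _ hdet]
  rw [Matrix.mul_assoc]
  exact mul_eq_one_comm.1 h1

namespace IsElliptical

variable {p : ℕ} {P : Measure (Fin p → ℝ)} {μ : Fin p → ℝ} {Sig : Matrix (Fin p) (Fin p) ℝ}
  {g : ℝ → ℝ}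

theorem memLp_coord (hP4 : ∀ j, Integrable (fun x : Fin p → ℝ => x j ^ 4) P) (j : Fin p) :
    MemLp (fun x : Fin p → ℝ => x j) 4 P :=
  memLp_four_of_integrable_pow (measurable_pi_apply j).aestronglyMeasurable (hP4 j)

theorem memLp_coord_sub (hP : IsElliptical P μ Sig g)
    (hP4 : ∀ j, Integrable (fun x : Fin p → ℝ => x j ^ 4) P) (j : Fin p) :
    MemLp (fun x : Fin p → ℝ => x j - μ j) 4 P :=
  have := hP.isProbabilityMeasure
  (memLp_coord hP4 j).sub (memLp_const _)

theorem memLp_dotProduct_sub (hP : IsElliptical P μ Sig g)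
    (hP4 : ∀ j, Integrable (fun x : Fin p → ℝ => x j ^ 4) P) (v : Fin p → ℝ) :
    MemLp (fun x : Fin p → ℝ => v ⬝ᵥ (x - μ)) 4 P := by
  simp only [dotProduct, Pi.sub_apply]
  exact memLp_finsetSum _ fun j _ => (hP.memLp_coord_sub hP4 j).const_mul (v j)

theorem integrable_sq_mul_sq (hP : IsElliptical P μ Sig g)
    (hP4 : ∀ j, Integrable (fun x : Fin p → ℝ => x j ^ 4) P) (v w : Fin p → ℝ) :
    Integrable (fun x : Fin p → ℝ => (v ⬝ᵥ (x - μ)) ^ 2 * (w ⬝ᵥ (x - μ)) ^ 2) P := by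
  have hv := hP.memLp_dotProduct_sub hP4 v
  have hw := hP.memLp_dotProduct_sub hP4 w
  simpa only [sq] using hv.integrable_mul_four hv hw hw

theorem integrable_pow_four (hP : IsElliptical P μ Sig g)
    (hP4 : ∀ j, Integrable (fun x : Fin p → ℝ => x j ^ 4) P) (v : Fin p → ℝ) :
    Integrable (fun x : Fin p → ℝ => (v ⬝ᵥ (x - μ)) ^ 4) P := by
  refine (hP.integrable_sq_mul_sq hP4 v v).congr (Filter.Eventually.of_forall fun x => ?_)
  simp only
  ring

theorem exists_integral_pow_four (hP : IsElliptical P μ Sig g) (hp : 1 ≤ p) :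
    ∃ m : ℝ, ∀ v : Fin p → ℝ,
      ∫ x, (v ⬝ᵥ (x - μ)) ^ 4 ∂P = m * (v ⬝ᵥ (Sig *ᵥ v)) ^ 2 := by
  have hpos : ∀ v : Fin p → ℝ, v ≠ 0 → 0 < v ⬝ᵥ (Sig *ᵥ v) := fun v hv => by
    simpa using hP.posDef.dotProduct_mulVec_pos hv
  let e : Fin p → ℝ := Pi.single ⟨0, hp⟩ 1
  have he : 0 < e ⬝ᵥ (Sig *ᵥ e) := hpos e (by simp [e])
  refine ⟨(∫ x, (e ⬝ᵥ (x - μ)) ^ 4 ∂P) / (e ⬝ᵥ (Sig *ᵥ e)) ^ 2, fun v => ?_⟩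
  rcases eq_or_ne v 0 with rfl | hv
  · simp
  have hv := hpos v hv
  -- The scale at which c • e has the same variance as v.
  set c := √(v ⬝ᵥ (Sig *ᵥ v) / (e ⬝ᵥ (Sig *ᵥ e)))
  have hc : c ^ 2 = v ⬝ᵥ (Sig *ᵥ v) / (e ⬝ᵥ (Sig *ᵥ e)) := Real.sq_sqrt (by positivity)
  have h := hP.integral_pow_four_congr (v := v) (w := c • e) (by
    simp only [Matrix.mulVec_smul, dotProduct_smul, smul_dotProduct, smul_eq_mul, ← mul_assoc,
      ← sq, hc]
    field_simp)
  rw [h]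
  simp only [smul_dotProduct, smul_eq_mul, mul_pow, integral_const_mul]
  rw [show c ^ 4 = (c ^ 2) ^ 2 by ring, hc]
  ring

/-- Polarization: 12 a²b² = (a+b)⁴ + (a-b)⁴ - 2a⁴ - 2b⁴. -/
theorem integral_sq_mul_sq_of_pow_four (hP : IsElliptical P μ Sig g)
    (hP4 : ∀ j, Integrable (fun x : Fin p → ℝ => x j ^ 4) P) {m : ℝ}
    (hm : ∀ v : Fin p → ℝ, ∫ x, (v ⬝ᵥ (x - μ)) ^ 4 ∂P = m * (v ⬝ᵥ (Sig *ᵥ v)) ^ 2)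
    (v w : Fin p → ℝ) :
    ∫ x, (v ⬝ᵥ (x - μ)) ^ 2 * (w ⬝ᵥ (x - μ)) ^ 2 ∂P =
      m / 3 * ((v ⬝ᵥ (Sig *ᵥ v)) * (w ⬝ᵥ (Sig *ᵥ w)) + 2 * (v ⬝ᵥ (Sig *ᵥ w)) ^ 2) := by
  have hpol : ∀ x, (v ⬝ᵥ (x - μ)) ^ 2 * (w ⬝ᵥ (x - μ)) ^ 2 =
      12⁻¹ * (((v + w) ⬝ᵥ (x - μ)) ^ 4 + ((v - w) ⬝ᵥ (x - μ)) ^ 4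
        - (2 * (v ⬝ᵥ (x - μ)) ^ 4 + 2 * (w ⬝ᵥ (x - μ)) ^ 4)) := fun x => by
    rw [add_dotProduct, sub_dotProduct]; ring
  have hi := hP.integrable_pow_four hP4
  simp_rw [hpol]
  rw [integral_const_mul, integral_sub ((hi _).fun_add (hi _))
    (((hi v).const_mul 2).fun_add ((hi w).const_mul 2)), integral_add (hi _) (hi _),
    integral_add ((hi v).const_mul 2) ((hi w).const_mul 2), integral_const_mul,
    integral_const_mul, hm, hm, hm, hm]
  simp only [Matrix.mulVec_add, Matrix.mulVec_sub, add_dotProduct, sub_dotProduct, dotProduct_add,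
    dotProduct_sub,
    Matrix.dotProduct_mulVec_comm_of_transpose_eq hP.posDef.transpose_eq w v]
  ring

/-- The whitened coordinates are uncorrelated with unit variance and r² is the sum of their squares,
so r⁴ contributes m/3 times the sum of 1 + 2δ_kl over k, l, which is p² + 2p. -/
theorem integral_esRadius_pow_four (hP : IsElliptical P μ Sig g)
    (hP4 : ∀ j, Integrable (fun x : Fin p → ℝ => x j ^ 4) P) {m : ℝ}
    (hm : ∀ v : Fin p → ℝ, ∫ x, (v ⬝ᵥ (x - μ)) ^ 4 ∂P = m * (v ⬝ᵥ (Sig *ᵥ v)) ^ 2) :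
    ∫ x, esRadius μ Sig x ^ 4 ∂P = m / 3 * ((p : ℝ) * ((p : ℝ) + 2)) := by
  obtain ⟨B, hB, hBA⟩ := hP.posDef.exists_inv_eq_transpose_mul_self
  have hq : ∀ x, mahalanobisSq μ Sig x = ∑ k, (B.row k ⬝ᵥ (x - μ)) ^ 2 := fun x => by
    rw [mahalanobisSq, hB, ← Matrix.mulVec_mulVec, Matrix.dotProduct_mulVec,
      Matrix.vecMul_transpose]
    simp [dotProduct, Matrix.mulVec, sq]
  have hr : ∀ x, esRadius μ Sig x ^ 4 =
      ∑ k, ∑ l, (B.row k ⬝ᵥ (x - μ)) ^ 2 * (B.row l ⬝ᵥ (x - μ)) ^ 2 := fun x => by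
    have h0 : 0 ≤ mahalanobisSq μ Sig x := by rw [hq]; positivity
    rw [esRadius, show (4 : ℕ) = 2 * 2 by rfl, pow_mul, Real.sq_sqrt h0, hq, sq,
      Finset.sum_mul_sum]
  have hBB : ∀ k l, B.row k ⬝ᵥ (Sig *ᵥ B.row l) = if k = l then 1 else 0 := fun k l => by
    have := congrFun (congrFun hBA k) l
    rw [Matrix.mul_assoc, Matrix.one_apply] at this
    rw [← this]
    rfl
  simp_rw [hr]
  rw [integral_finsetSum _ fun k _ => integrable_finsetSum _ fun l _ =>
    hP.integrable_sq_mul_sq hP4 _ _]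
  simp_rw [integral_finsetSum _ fun l _ => hP.integrable_sq_mul_sq hP4 (B.row _) (B.row l),
    hP.integral_sq_mul_sq_of_pow_four hP4 hm, hBB, ← Finset.mul_sum]
  congr 1
  simp [Finset.sum_add_distrib]
  ring

/-- The fourth moment of a linear form of an elliptical vector in terms of the kurtosis. -/
theorem integral_pow_four (hP : IsElliptical P μ Sig g) (hp : 1 ≤ p)
    (hP4 : ∀ j, Integrable (fun x : Fin p → ℝ => x j ^ 4) P) (v : Fin p → ℝ) :
    ∫ x, (v ⬝ᵥ (x - μ)) ^ 4 ∂P =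
      3 * (1 + ellKurtosis P μ Sig) * (v ⬝ᵥ (Sig *ᵥ v)) ^ 2 := by
  obtain ⟨m, hm⟩ := hP.exists_integral_pow_four hp
  have hp0 : (0 : ℝ) < p := by exact_mod_cast hp
  rw [hm, ellKurtosis, hP.integral_esRadius_pow_four hP4 hm]
  field_simp
  ring

/-- The mixed fourth moments of two coordinates of an elliptical vector. -/
theorem integral_coord_sq_mul_sq (hP : IsElliptical P μ Sig g) (hp : 1 ≤ p)
    (hP4 : ∀ j, Integrable (fun x : Fin p → ℝ => x j ^ 4) P) (i j : Fin p) :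
    ∫ x, (x i - μ i) ^ 2 * (x j - μ j) ^ 2 ∂P =
      (1 + ellKurtosis P μ Sig) * (Sig i i * Sig j j + 2 * Sig i j ^ 2) := by
  have h := hP.integral_sq_mul_sq_of_pow_four hP4 (hP.integral_pow_four hp hP4)
    (Pi.single i 1) (Pi.single j 1)
  simp at h
  rw [h]

/-- The variance of (x_i - μ_i)² is nonnegative, that is 3(1+κ) ≥ 1. This keeps the denominators of
a_n and b_n away from zero. -/
theorem neg_two_thirds_le_ellKurtosis (hP : IsElliptical P μ Sig g) (hp : 1 ≤ p)
    (hP4 : ∀ j, Integrable (fun x : Fin p → ℝ => x j ^ 4) P) :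
    -(2 / 3) ≤ ellKurtosis P μ Sig := by
  have := hP.isProbabilityMeasure
  obtain ⟨i⟩ : Nonempty (Fin p) := ⟨⟨0, hp⟩⟩
  have hs : 0 < Sig i i := hP.posDef.diag_pos
  have h1 := hP.memLp_coord_sub hP4 i
  have h2 := hP.integral_mul_eq (fun j => (memLp_coord hP4 j).integrable (by norm_num)) i i
  have h4 := hP.integral_coord_sq_mul_sq hp hP4 i i
  have hi2 : Integrable (fun x : Fin p → ℝ => (x i - μ i) * (x i - μ i)) P :=
    (h1.mul_memLp_two h1).integrable (by norm_num)
  have hi4 : Integrable (fun x : Fin p → ℝ => (x i - μ i) ^ 2 * (x i - μ i) ^ 2) P := by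
    simpa only [sq] using h1.integrable_mul_four h1 h1 h1
  have hi42 : Integrable (fun x : Fin p → ℝ => (x i - μ i) ^ 2 * (x i - μ i) ^ 2
      - 2 * Sig i i * ((x i - μ i) * (x i - μ i))) P := hi4.sub (hi2.const_mul _)
  have hnn : 0 ≤ ∫ x, ((x i - μ i) * (x i - μ i) - Sig i i) ^ 2 ∂P :=
    integral_nonneg fun _ => sq_nonneg _
  have hexp : ∀ x : Fin p → ℝ, ((x i - μ i) * (x i - μ i) - Sig i i) ^ 2 =
      (x i - μ i) ^ 2 * (x i - μ i) ^ 2 - 2 * Sig i i * ((x i - μ i) * (x i - μ i))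
        + Sig i i ^ 2 := fun x => by ring
  rw [integral_congr_ae (Filter.Eventually.of_forall hexp), integral_add hi42 (integrable_const _),
    integral_sub hi4 (hi2.const_mul _), integral_const_mul, h2, h4] at hnn
  simp only [integral_const, probReal_univ, one_smul] at hnn
  have h5 : 0 ≤ Sig i i ^ 2 * (3 * ellKurtosis P μ Sig + 2) := by linarith
  have := nonneg_of_mul_nonneg_right h5 (by positivity)
  linarith

end IsElliptical

/-! ### Fourth-order product moments under independence. -/

section PiMoments

variable {E : Type*} [MeasurableSpace E] {P : Measure E} [IsProbabilityMeasure P] {n : ℕ}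

/-- An index occurring only once splits off its mean; l, s, t may coincide among themselves. For
centred factors the whole moment vanishes. -/
theorem integral_pi_mul_of_forall_ne {k l s t : Fin n} (hl : l ≠ k) (hs : s ≠ k) (ht : t ≠ k)
    {a b c d : E → ℝ} (ha : Measurable a) (hb : Measurable b) (hc : Measurable c)
    (hd : Measurable d) :
    ∫ x, a (x k) * (b (x l) * c (x s) * d (x t)) ∂Measure.pi (fun _ : Fin n => P) =
      (∫ x, a x ∂P) * ∫ x, b (x l) * c (x s) * d (x t) ∂Measure.pi (fun _ : Fin n => P) := by
  have hI : iIndepFun (fun (i : Fin n) (x : Fin n → E) => x i) (Measure.pi fun _ => P) :=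
    iIndepFun_pi (X := fun _ => id) fun _ => aemeasurable_id
  have hdis : Disjoint ({k} : Finset (Fin n)) {l, s, t} := by
    simp [hl.symm, hs.symm, ht.symm]
  have h := hI.indepFun_finset {k} {l, s, t} hdis (fun i => measurable_pi_apply i)
  have h2 := h.comp (φ := fun r : ({k} : Finset (Fin n)) → E => a (r ⟨k, by simp⟩))
    (ψ := fun r : ({l, s, t} : Finset (Fin n)) → E => b (r ⟨l, by simp⟩) * c (r ⟨s, by simp⟩) * d (r ⟨t, by simp⟩))
    (by fun_prop) (by fun_prop)
  have h3 := h2.integral_fun_mul_eq_mul_integral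
    (by simp only [Function.comp_def]; exact (by fun_prop : Measurable _).aestronglyMeasurable)
    (by simp only [Function.comp_def]; exact (by fun_prop : Measurable _).aestronglyMeasurable)
  simp only [Function.comp_def] at h3
  rw [h3, integral_comp_eval (μ := fun _ : Fin n => P) ha.aestronglyMeasurable]

theorem integral_pi_mul_of_ne {k l : Fin n} (h : k ≠ l) {a b : E → ℝ} (ha : Measurable a)
    (hb : Measurable b) :
    ∫ x, a (x k) * b (x l) ∂Measure.pi (fun _ : Fin n => P) =
      (∫ x, a x ∂P) * ∫ x, b x ∂P := by
  have := integral_pi_mul_of_forall_ne (P := P) h.symm h.symm h.symm ha hb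
    (measurable_const (a := (1 : ℝ))) (measurable_const (a := (1 : ℝ)))
  simp only [mul_one] at this
  rw [this, integral_comp_eval (μ := fun _ : Fin n => P) hb.aestronglyMeasurable]

/-- The fourth-order moments of an i.i.d. sample of centred variables, as the sum over the
partitions of the four factors into pairs plus the contribution of the fourth cumulant. -/
theorem integral_pi_mul_four {a b c d : E → ℝ} (ha : Measurable a)
    (hb : Measurable b) (hc : Measurable c) (hd : Measurable d) (ha0 : ∫ x, a x ∂P = 0)
    (hb0 : ∫ x, b x ∂P = 0) (hc0 : ∫ x, c x ∂P = 0) (hd0 : ∫ x, d x ∂P = 0) (k l s t : Fin n) :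
    ∫ x, a (x k) * b (x l) * (c (x s) * d (x t)) ∂Measure.pi (fun _ : Fin n => P) =
      (if k = l then (if s = t then (∫ x, a x * b x ∂P) * ∫ x, c x * d x ∂P else 0) else 0)
      + (if k = s then (if l = t then (∫ x, a x * c x ∂P) * ∫ x, b x * d x ∂P else 0) else 0)
      + (if k = t then (if l = s then (∫ x, a x * d x ∂P) * ∫ x, b x * c x ∂P else 0) else 0)
      + (if k = l then (if s = t then (if k = s then ((∫ x, a x * b x * (c x * d x) ∂P)
          - (∫ x, a x * b x ∂P) * (∫ x, c x * d x ∂P)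
          - (∫ x, a x * c x ∂P) * (∫ x, b x * d x ∂P)
          - (∫ x, a x * d x ∂P) * (∫ x, b x * c x ∂P)) else 0) else 0) else 0) := by
  by_cases hkl : k = l
  · subst hkl
    by_cases hst : s = t
    · subst hst
      by_cases hks : k = s
      · subst hks
        simp only [if_true]
        rw [integral_comp_eval (μ := fun _ : Fin n => P) (i := k)
          (f := fun y => a y * b y * (c y * d y)) (by fun_prop : Measurable _).aestronglyMeasurable]
        ring
      · simp only [hks, if_true, if_false]
        rw [integral_pi_mul_of_ne hks (a := fun y => a y * b y) (b := fun y => c y * d y)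
          (by fun_prop) (by fun_prop)]
        ring
    -- As s ≠ t, one of them occurs alone: t if s = k, and s otherwise.
    · have h0 : ∫ x, a (x k) * b (x k) * (c (x s) * d (x t)) ∂Measure.pi (fun _ : Fin n => P)
          = 0 := by
        by_cases hks : k = s
        · have : ∀ x : Fin n → E, a (x k) * b (x k) * (c (x s) * d (x t)) =
              d (x t) * (a (x k) * b (x k) * c (x s)) := fun x => by ring
          simp_rw [this]
          rw [integral_pi_mul_of_forall_ne (by grind) (by grind) hst hd ha hb hc, hd0, zero_mul]
        · have : ∀ x : Fin n → E, a (x k) * b (x k) * (c (x s) * d (x t)) =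
              c (x s) * (a (x k) * b (x k) * d (x t)) := fun x => by ring
          simp_rw [this]
          rw [integral_pi_mul_of_forall_ne hks hks (Ne.symm hst) hc ha hb hd, hc0, zero_mul]
      rw [h0]
      grind
  · by_cases hks : k = s
    · subst hks
      by_cases hlt : l = t
      · subst hlt
        have : ∀ x : Fin n → E, a (x k) * b (x l) * (c (x k) * d (x l)) =
            (a (x k) * c (x k)) * (b (x l) * d (x l)) := fun x => by ring
        simp_rw [this]
        rw [integral_pi_mul_of_ne hkl (a := fun y => a y * c y) (b := fun y => b y * d y)
          (by fun_prop) (by fun_prop)]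
        simp [hkl]
      · have : ∀ x : Fin n → E, a (x k) * b (x l) * (c (x k) * d (x t)) =
            b (x l) * (a (x k) * c (x k) * d (x t)) := fun x => by ring
        simp_rw [this]
        rw [integral_pi_mul_of_forall_ne hkl hkl (Ne.symm hlt) hb ha hc hd, hb0, zero_mul]
        grind
    · by_cases hkt : k = t
      · subst hkt
        by_cases hls : l = s
        · subst hls
          have : ∀ x : Fin n → E, a (x k) * b (x l) * (c (x l) * d (x k)) =
              (a (x k) * d (x k)) * (b (x l) * c (x l)) := fun x => by ring
          simp_rw [this]
          rw [integral_pi_mul_of_ne hkl (a := fun y => a y * d y) (b := fun y => b y * c y)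
            (by fun_prop) (by fun_prop)]
          simp [hkl]
        · have : ∀ x : Fin n → E, a (x k) * b (x l) * (c (x s) * d (x k)) =
              b (x l) * (a (x k) * c (x s) * d (x k)) := fun x => by ring
          simp_rw [this]
          rw [integral_pi_mul_of_forall_ne hkl (Ne.symm hls) hkl hb ha hc hd, hb0, zero_mul]
          grind
      · have : ∀ x : Fin n → E, a (x k) * b (x l) * (c (x s) * d (x t)) =
            a (x k) * (b (x l) * c (x s) * d (x t)) := fun x => by ring
        simp_rw [this]
        rw [integral_pi_mul_of_forall_ne (Ne.symm hkl) (Ne.symm hks) (Ne.symm hkt) ha hb hc hd,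
          ha0, zero_mul]
        grind

end PiMoments

/-! ### Second moments of the sample covariance matrix. -/

/-- The entries of the centering matrix `1 - n⁻¹ J`. -/
noncomputable def centeringCoef {n : ℕ} (k l : Fin n) : ℝ := (if k = l then 1 else 0) - (n : ℝ)⁻¹

/-- The centering matrix annihilates constants, so the data may be shifted by μ. -/
theorem sampleCov_apply_eq_sum {n p : ℕ} (hn : n ≠ 0) (μ : Fin p → ℝ) (x : Fin n → Fin p → ℝ)
    (i j : Fin p) :
    sampleCov x i j =
      ((n : ℝ) - 1)⁻¹ * ∑ k, ∑ l, centeringCoef k l * ((x k i - μ i) * (x l j - μ j)) := by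
  have hn0 : (n : ℝ) ≠ 0 := by exact_mod_cast hn
  have hmean : ∀ k q, x k q - sampleMean x q =
      (x k q - μ q) - (n : ℝ)⁻¹ * ∑ l, (x l q - μ q) := fun k q => by
    simp [sampleMean, Finset.sum_sub_distrib, mul_sub, hn0]
  simp only [sampleCov, Matrix.smul_apply, Matrix.sum_apply, Matrix.vecMulVec_apply, Pi.sub_apply,
    smul_eq_mul, hmean]
  congr 1
  generalize hY : (fun k => x k i - μ i) = Y
  generalize hZ : (fun k => x k j - μ j) = Z
  have hY' : ∀ k, x k i - μ i = Y k := fun k => by rw [← hY]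
  have hZ' : ∀ k, x k j - μ j = Z k := fun k => by rw [← hZ]
  simp only [hY', hZ', centeringCoef]
  have h1 : ∑ k, (Y k - (n : ℝ)⁻¹ * ∑ l, Y l) * (Z k - (n : ℝ)⁻¹ * ∑ l, Z l) =
      ∑ k, Y k * Z k - (n : ℝ)⁻¹ * ((∑ k, Y k) * ∑ l, Z l) := by
    simp only [sub_mul, mul_sub, Finset.sum_sub_distrib, ← Finset.sum_mul, ← Finset.mul_sum,
      Finset.sum_const, Finset.card_univ, Fintype.card_fin, nsmul_eq_mul]
    field_simp
    ring
  rw [h1, Finset.sum_mul_sum]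
  simp [sub_mul, Finset.sum_sub_distrib, Finset.mul_sum]

/-- Each pairing contracts the indices of c ⊗ c; the four scalars that remain are evaluated below
for the centering matrix. -/
theorem sum_pairings {n : ℕ} (c : Fin n → Fin n → ℝ) (α β γ δ : ℝ) :
    ∑ k, ∑ l, ∑ s, ∑ t, c k l * c s t *
      ((if k = l then (if s = t then α else 0) else 0)
        + (if k = s then (if l = t then β else 0) else 0)
        + (if k = t then (if l = s then γ else 0) else 0)
        + (if k = l then (if s = t then (if k = s then δ else 0) else 0) else 0)) =
      (∑ k, c k k) ^ 2 * α + (∑ k, ∑ l, c k l * c k l) * β + (∑ k, ∑ l, c k l * c l k) * γ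
        + (∑ k, c k k * c k k) * δ := by
  have h : (∑ k, c k k) ^ 2 * α = ∑ k, ∑ s, c k k * c s s * α := by
    rw [sq, Finset.sum_mul_sum]
    simp only [Finset.sum_mul]
  rw [h]
  simp only [mul_add, Finset.sum_add_distrib, mul_ite, mul_zero, Finset.sum_ite_irrel,
    Finset.sum_const_zero, Finset.sum_ite_eq, Finset.mem_univ, if_true, Finset.sum_mul]

theorem sum_centeringCoef_self {n : ℕ} (hn : n ≠ 0) :
    ∑ k : Fin n, centeringCoef k k = (n : ℝ) - 1 := by
  simp [centeringCoef, hn]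

theorem sum_centeringCoef_self_sq {n : ℕ} (hn : n ≠ 0) :
    ∑ k : Fin n, centeringCoef k k * centeringCoef k k = ((n : ℝ) - 1) ^ 2 / n := by
  have hn0 : (n : ℝ) ≠ 0 := by exact_mod_cast hn
  simp [centeringCoef]
  field_simp

/-- The centering matrix is a symmetric projection, so its squared Frobenius norm is its trace. -/
theorem sum_centeringCoef_sq {n : ℕ} (hn : n ≠ 0) :
    ∑ k : Fin n, ∑ l, centeringCoef k l * centeringCoef k l = (n : ℝ) - 1 := by
  have hn0 : (n : ℝ) ≠ 0 := by exact_mod_cast hn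
  simp [centeringCoef, sub_mul, mul_sub, Finset.sum_sub_distrib]
  field_simp
  ring

theorem sum_centeringCoef_mul_swap {n : ℕ} (hn : n ≠ 0) :
    ∑ k : Fin n, ∑ l, centeringCoef k l * centeringCoef l k = (n : ℝ) - 1 := by
  simpa only [centeringCoef, eq_comm] using sum_centeringCoef_sq hn

section SampleCovariance

variable {n p : ℕ} {P : Measure (Fin p → ℝ)} [IsProbabilityMeasure P] {μ : Fin p → ℝ}

theorem memLp_pi_coord_sub (hL : ∀ i, MemLp (fun x : Fin p → ℝ => x i - μ i) 4 P) (k : Fin n)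
    (i : Fin p) :
    MemLp (fun x : Fin n → Fin p → ℝ => x k i - μ i) 4 (Measure.pi fun _ => P) :=
  (hL i).comp_measurePreserving (measurePreserving_eval (fun _ : Fin n => P) k)

theorem sampleCov_mul_sampleCov_eq_sum (hn : n ≠ 0) (μ : Fin p → ℝ) (x : Fin n → Fin p → ℝ)
    (i j a b : Fin p) :
    sampleCov x i j * sampleCov x a b =
      (((n : ℝ) - 1)⁻¹) ^ 2 * ∑ k, ∑ l, ∑ s, ∑ t, centeringCoef k l * centeringCoef s t *
        ((x k i - μ i) * (x l j - μ j) * ((x s a - μ a) * (x t b - μ b))) := by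
  rw [sampleCov_apply_eq_sum hn μ, sampleCov_apply_eq_sum hn μ, mul_mul_mul_comm, ← sq,
    Finset.sum_mul]
  congr 1
  refine Finset.sum_congr rfl fun k _ => ?_
  rw [Finset.sum_mul]
  refine Finset.sum_congr rfl fun l _ => ?_
  rw [Finset.mul_sum]
  refine Finset.sum_congr rfl fun s _ => ?_
  rw [Finset.mul_sum]
  refine Finset.sum_congr rfl fun t _ => ?_
  ring

theorem integrable_sampleCov_mul_sampleCov (hn : n ≠ 0)
    (hL : ∀ i, MemLp (fun x : Fin p → ℝ => x i - μ i) 4 P) (i j a b : Fin p) :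
    Integrable (fun x : Fin n → Fin p → ℝ => sampleCov x i j * sampleCov x a b)
      (Measure.pi fun _ => P) := by
  simp_rw [sampleCov_mul_sampleCov_eq_sum hn μ]
  refine Integrable.const_mul ?_ _
  refine integrable_finsetSum _ fun k _ => integrable_finsetSum _ fun l _ =>
    integrable_finsetSum _ fun s _ => integrable_finsetSum _ fun t _ => Integrable.const_mul ?_ _
  exact (memLp_pi_coord_sub hL k i).integrable_mul_four (memLp_pi_coord_sub hL l j)
    (memLp_pi_coord_sub hL s a) (memLp_pi_coord_sub hL t b)

/-- Second-order moments of the entries of the sample covariance matrix. -/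
theorem integral_sampleCov_mul_sampleCov (hn : 2 ≤ n)
    (hL : ∀ i, MemLp (fun x : Fin p → ℝ => x i - μ i) 4 P)
    (h0 : ∀ i, ∫ x, (x i - μ i) ∂P = 0) {Sig : Matrix (Fin p) (Fin p) ℝ}
    (hSig : ∀ i j, ∫ x, (x i - μ i) * (x j - μ j) ∂P = Sig i j) (i j a b : Fin p) :
    ∫ x : Fin n → Fin p → ℝ, sampleCov x i j * sampleCov x a b ∂Measure.pi (fun _ => P) =
      Sig i j * Sig a b + (Sig i a * Sig j b + Sig i b * Sig j a) / ((n : ℝ) - 1)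
        + ((∫ x, (x i - μ i) * (x j - μ j) * ((x a - μ a) * (x b - μ b)) ∂P) - Sig i j * Sig a b
          - Sig i a * Sig j b - Sig i b * Sig j a) / n := by
  have hn0 : n ≠ 0 := by omega
  have hn0' : (n : ℝ) ≠ 0 := by exact_mod_cast hn0
  have hn1 : (n : ℝ) - 1 ≠ 0 := by
    have : (2 : ℝ) ≤ n := by exact_mod_cast hn
    linarith
  have hint : ∀ k l s t : Fin n, Integrable (fun x : Fin n → Fin p → ℝ =>
      centeringCoef k l * centeringCoef s t *
        ((x k i - μ i) * (x l j - μ j) * ((x s a - μ a) * (x t b - μ b))))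
      (Measure.pi fun _ => P) := fun k l s t =>
    ((memLp_pi_coord_sub hL k i).integrable_mul_four (memLp_pi_coord_sub hL l j)
      (memLp_pi_coord_sub hL s a) (memLp_pi_coord_sub hL t b)).const_mul _
  have hm : ∀ q : Fin p, Measurable fun x : Fin p → ℝ => x q - μ q := fun q => by fun_prop
  have hquad : ∀ k l s t : Fin n, ∫ x : Fin n → Fin p → ℝ, centeringCoef k l * centeringCoef s t *
        ((x k i - μ i) * (x l j - μ j) * ((x s a - μ a) * (x t b - μ b))) ∂Measure.pi (fun _ => P)
      = _ := fun k l s t => by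
    rw [integral_const_mul, integral_pi_mul_four (hm i) (hm j) (hm a) (hm b) (h0 i) (h0 j) (h0 a)
      (h0 b) k l s t, hSig, hSig, hSig, hSig, hSig, hSig]
  simp_rw [sampleCov_mul_sampleCov_eq_sum hn0 μ]
  rw [integral_const_mul, integral_finsetSum _ fun k _ => integrable_finsetSum _ fun l _ =>
    integrable_finsetSum _ fun s _ => integrable_finsetSum _ fun t _ => hint k l s t]
  have hsum : ∀ k : Fin n, ∫ x : Fin n → Fin p → ℝ, ∑ l, ∑ s, ∑ t,
      centeringCoef k l * centeringCoef s t *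
        ((x k i - μ i) * (x l j - μ j) * ((x s a - μ a) * (x t b - μ b))) ∂Measure.pi (fun _ => P)
      = ∑ l, ∑ s, ∑ t, _ := fun k => by
    rw [integral_finsetSum _ fun l _ => integrable_finsetSum _ fun s _ =>
      integrable_finsetSum _ fun t _ => hint k l s t]
    refine Finset.sum_congr rfl fun l _ => ?_
    rw [integral_finsetSum _ fun s _ => integrable_finsetSum _ fun t _ => hint k l s t]
    refine Finset.sum_congr rfl fun s _ => ?_
    rw [integral_finsetSum _ fun t _ => hint k l s t]
  rw [Finset.sum_congr rfl fun k _ => hsum k]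
  simp_rw [hquad]
  rw [sum_pairings, sum_centeringCoef_self hn0, sum_centeringCoef_self_sq hn0, sum_centeringCoef_sq hn0,
    sum_centeringCoef_mul_swap hn0]
  field_simp
  ring

end SampleCovariance

/-! ### Unbiasedness. -/

theorem thetaHat_eq_sum {n p : ℕ} (κ : ℝ) {W : Matrix (Fin p) (Fin p) ℝ} (hW : W.IsSymm)
    (x : Fin n → Fin p → ℝ) :
    thetaHat κ W x = bCoef n κ / p * ∑ i, ∑ j, W i j ^ 2 *
      (sampleCov x i j * sampleCov x i j - aCoef n κ * (sampleCov x i i * sampleCov x j j)) := by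
  have h1 : frobSq (W ⊙ sampleCov x) =
      ∑ i, ∑ j, W i j ^ 2 * (sampleCov x i j * sampleCov x i j) := by
    rw [frobSq, Matrix.trace, Finset.sum_comm]
    refine Finset.sum_congr rfl fun i _ => ?_
    simp only [Matrix.diag_apply, Matrix.mul_apply, Matrix.transpose_apply,
      Matrix.hadamard_apply]
    exact Finset.sum_congr rfl fun j _ => by ring
  have h2 : ((diagPart (sampleCov x) * W) ^ 2).trace =
      ∑ i, ∑ j, W i j ^ 2 * (sampleCov x i i * sampleCov x j j) := by
    rw [sq, Matrix.trace]
    refine Finset.sum_congr rfl fun i _ => ?_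
    rw [Matrix.diag_apply, Matrix.mul_apply]
    refine Finset.sum_congr rfl fun j _ => ?_
    simp only [diagPart, Matrix.diagonal_mul, Matrix.diag_apply, hW.apply i j]
    ring
  rw [thetaHat, h1, h2]
  simp only [mul_sub, Finset.sum_sub_distrib, Finset.mul_sum, Finset.sum_div]
  congr 1 <;>
    exact Finset.sum_congr rfl fun i _ => Finset.sum_congr rfl fun j _ => by ring

/-- Here τ = σ_ij² and ρ = σ_ii σ_jj. The weight of ρ is 1/(n-1) + κ/n in the first moment and 1 +
κ/n in the second; their ratio is a_n. -/
theorem bCoef_mul_eq {n : ℕ} (hn : 3 ≤ n) {κ : ℝ} (hκ : -(2 / 3) ≤ κ) (σ τ ρ : ℝ) (hτ : τ = σ ^ 2) :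
    bCoef n κ * ((τ + (ρ + τ) / ((n : ℝ) - 1) + ((1 + κ) * (ρ + 2 * τ) - τ - ρ - τ) / n)
      - aCoef n κ * (ρ + (τ + τ) / ((n : ℝ) - 1) + ((1 + κ) * (ρ + 2 * τ) - ρ - τ - τ) / n))
      = σ ^ 2 := by
  have hn3 : (3 : ℝ) ≤ n := by exact_mod_cast hn
  have h0 : (n : ℝ) ≠ 0 := by linarith
  have h1 : (n : ℝ) - 1 ≠ 0 := by linarith
  have h2 : (n : ℝ) - 2 ≠ 0 := by linarith
  have h3 : (n : ℝ) + κ ≠ 0 := by linarith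
  -- By κ ≥ -2/3 the left side is at least n² - n + 2 > 0.
  have h4 : 3 * κ * ((n : ℝ) - 1) + n * (n + 1) ≠ 0 := by nlinarith
  obtain ⟨D, hD⟩ : ∃ D, D = 3 * κ * ((n : ℝ) - 1) + n * (n + 1) := ⟨_, rfl⟩
  rw [bCoef, aCoef, ← hτ, ← hD]
  rw [← hD] at h4
  field_simp
  rw [hD]
  ring

theorem theorem2 {Ω : Type*} [MeasurableSpace Ω] (Pr : Measure Ω) [IsProbabilityMeasure Pr]
    (n p : ℕ) (hn : 3 ≤ n) (hp : 1 ≤ p)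
    (μ : Fin p → ℝ) (Sig : Matrix (Fin p) (Fin p) ℝ) (g : ℝ → ℝ)
    (P : Measure (Fin p → ℝ)) (hP : IsElliptical P μ Sig g)
    (hP4 : ∀ j, Integrable (fun x : Fin p → ℝ => x j ^ 4) P)
    (X : Fin n → Ω → Fin p → ℝ) (hX : ∀ i, HasLaw (X i) P Pr) (hindep : iIndepFun X Pr)
    (W : Matrix (Fin p) (Fin p) ℝ) (hW : W ∈ taperSet p) :
    Integrable (fun ω => thetaHat (ellKurtosis P μ Sig) W (fun i => X i ω)) Pr ∧
      ∫ ω, thetaHat (ellKurtosis P μ Sig) W (fun i => X i ω) ∂Pr = thetaW W Sig := by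
  have := hP.isProbabilityMeasure
  have hn0 : n ≠ 0 := by omega
  -- An i.i.d. sample has the product law, so everything is computed on the product space.
  have hlaw : HasLaw (fun ω i => X i ω) (Measure.pi fun _ : Fin n => P) Pr :=
    iIndepFun.hasLaw_pi hX hindep
  have hL := hP.memLp_coord_sub hP4
  have hcov := hP.integral_mul_eq
    (fun j => (IsElliptical.memLp_coord hP4 j).integrable (by norm_num))
  set κ := ellKurtosis P μ Sig
  have hSS := integrable_sampleCov_mul_sampleCov (n := n) hn0 hL
  have hterm : ∀ i j, Integrable (fun x : Fin n → Fin p → ℝ => W i j ^ 2 *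
      (sampleCov x i j * sampleCov x i j - aCoef n κ * (sampleCov x i i * sampleCov x j j)))
      (Measure.pi fun _ => P) := fun i j =>
    ((hSS i j i j).sub ((hSS i i j j).const_mul _)).const_mul _
  have hint : Integrable (fun x : Fin n → Fin p → ℝ => thetaHat κ W x)
      (Measure.pi fun _ => P) := by
    simp_rw [thetaHat_eq_sum κ hW.1]
    exact (integrable_finsetSum _ fun i _ => integrable_finsetSum _ fun j _ =>
      hterm i j).const_mul _
  refine ⟨?_, ?_⟩
  · rw [← hlaw.map_eq] at hint
    exact hint.comp_aemeasurable hlaw.aemeasurable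
  have htrans := hlaw.integral_comp hint.aestronglyMeasurable
  rw [Function.comp_def] at htrans
  rw [htrans]
  simp_rw [thetaHat_eq_sum κ hW.1]
  rw [integral_const_mul, integral_finsetSum _ fun i _ => integrable_finsetSum _ fun j _ =>
    hterm i j]
  -- Unbiasedness already holds for each entry separately.
  have hmom : ∀ i j, bCoef n κ * ∫ x : Fin n → Fin p → ℝ, W i j ^ 2 *
      (sampleCov x i j * sampleCov x i j - aCoef n κ * (sampleCov x i i * sampleCov x j j))
      ∂Measure.pi (fun _ => P) = W i j ^ 2 * Sig i j ^ 2 := fun i j => by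
    have hsym : Sig j i = Sig i j := by
      conv_lhs => rw [← hP.posDef.transpose_eq, Matrix.transpose_apply]
    have h4 : ∫ x, (x i - μ i) * (x j - μ j) * ((x i - μ i) * (x j - μ j)) ∂P =
        (1 + κ) * (Sig i i * Sig j j + 2 * (Sig i j * Sig i j)) := by
      rw [← sq (Sig i j), ← hP.integral_coord_sq_mul_sq hp hP4 i j]
      exact integral_congr_ae (Filter.Eventually.of_forall fun x => by ring)
    have h4' : ∫ x, (x i - μ i) * (x i - μ i) * ((x j - μ j) * (x j - μ j)) ∂P =
        (1 + κ) * (Sig i i * Sig j j + 2 * (Sig i j * Sig i j)) := by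
      rw [← h4]
      exact integral_congr_ae (Filter.Eventually.of_forall fun x => by ring)
    rw [integral_const_mul, integral_sub (hSS i j i j) ((hSS i i j j).const_mul _),
      integral_const_mul,
      integral_sampleCov_mul_sampleCov (by omega) hL hP.integral_sub_eq_zero hcov,
      integral_sampleCov_mul_sampleCov (by omega) hL hP.integral_sub_eq_zero hcov, h4, h4', hsym,
      mul_left_comm, bCoef_mul_eq hn (hP.neg_two_thirds_le_ellKurtosis hp hP4) (Sig i j)
      (Sig i j * Sig i j) (Sig i i * Sig j j) (sq _).symm]
  have hfrob : frobSq (W ⊙ Sig) = ∑ i, ∑ j, W i j ^ 2 * Sig i j ^ 2 := by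
    rw [frobSq, Matrix.trace, Finset.sum_comm]
    refine Finset.sum_congr rfl fun i _ => ?_
    simp only [Matrix.diag_apply, Matrix.mul_apply, Matrix.transpose_apply,
      Matrix.hadamard_apply]
    exact Finset.sum_congr rfl fun j _ => by ring
  rw [thetaW, hfrob, div_mul_eq_mul_div]
  congr 1
  rw [Finset.mul_sum]
  refine Finset.sum_congr rfl fun i _ => ?_
  rw [integral_finsetSum _ fun j _ => hterm i j, Finset.mul_sum]
  exact Finset.sum_congr rfl fun j _ => hmom i j
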